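/- Let $H$ be a complex Hilbert space and let $M\subseteq B(H)$ be a von Neumann algebra. Write $M_{sa}=\{x\in M: x=x^*\}$, $M_{sa}^1=\{x\in M_{sa}:\|x\|\le 1\}$ and $P(M)=\{p\in M: p=p^*=p^2\}$, each partially ordered by the usual operator order. $M$ is called $\sigma$-finite if every set of nonzero pairwise orthogonal projections in $M$ is at most countable. For a partially ordered set $P$, a net $(x_\gamma)_{\gamma\in\Gamma}$ in $P$ order converges to $x\in P$ if there are nets $(y_\gamma)_{\gamma\in\Gamma}$, $(z_\gamma)_{\gamma\in\Gamma}$ in $P$ with $y_\gamma\le x_\gamma\le z_\gamma$ for all $\gamma$, $(y_\gamma)$ increasing with supremum $x$ in $P$, and $(z_\gamma)$ decreasing with infimum $x$ in $P$. The order topology $\tau_o(P)$ (resp. the sequential order topology $\tau_{os}(P)$) is the topology on $P$ whose closed sets are those $X\subseteq P$ such that no net (resp. sequence) in $X$ order converges to a point outside $X$. Then the following four statements are equivalent: (i) $M$ is $\sigma$-finite; (ii) $\tau_{os}(M_{sa})=\tau_o(M_{sa})$; (iii) $\tau_{os}(M_{sa}^1)=\tau_o(M_{sa}^1)$; (iv)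 $\tau_{os}(P(M))=\tau_o(P(M))$. -/

import Mathlib

universe u

/-- The net `x : Γ → P` order converges to `a`: there are nets `y`, `z` over the same index set with
`y γ ≤ x γ ≤ z γ` for all `γ`, `y` increasing with supremum `a`, `z` decreasing with infimum `a`. -/
def OrderConverges {P Γ : Type*} [PartialOrder P] [Preorder Γ] (x : Γ → P) (a : P) : Prop :=
  ∃ y z : Γ → P, (∀ γ, y γ ≤ x γ ∧ x γ ≤ z γ) ∧
    Monotone y ∧ IsLUB (Set.range y) a ∧ Antitone z ∧ IsGLB (Set.range z) a

/-- No net in `X` order converges to a point outside of `X`. Index sets are nonempty directed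
preorders in the universe of `P`; larger index sets give nothing more, since a net together with its
two bounding nets can be reindexed by the set of triples `(y γ, x γ, z γ)`. -/
def IsOrderClosed {P : Type u} [PartialOrder P] (X : Set P) : Prop :=
  ∀ (Γ : Type u) [Preorder Γ] [IsDirectedOrder Γ] [Nonempty Γ] (x : Γ → P) (a : P),
    (∀ γ, x γ ∈ X) → OrderConverges x a → a ∈ X

/-- No sequence in `X` order converges to a point outside of `X`. -/
def IsSeqOrderClosed {P : Type u} [PartialOrder P] (X : Set P) : Prop :=
  ∀ (x : ℕ → P) (a : P), (∀ n, x n ∈ X) → OrderConverges x a → a ∈ X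

/-- Order convergence passes to a net along a monotone cofinal map of index sets. -/
theorem OrderConverges.comp {P Γ Δ : Type*} [PartialOrder P] [Preorder Γ] [Preorder Δ]
    {x : Γ → P} {a : P} (h : OrderConverges x a) (f : Δ → Γ) (hf : Monotone f)
    (hc : ∀ γ, ∃ δ, γ ≤ f δ) : OrderConverges (x ∘ f) a := by
  obtain ⟨y, z, hb, hy, hya, hz, hza⟩ := h
  refine ⟨y ∘ f, z ∘ f, fun δ => hb (f δ), hy.comp hf, ⟨?_, ?_⟩, hz.comp_monotone hf, ⟨?_, ?_⟩⟩
  · rintro _ ⟨δ, rfl⟩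
    exact hya.1 ⟨f δ, rfl⟩
  · intro b hbb
    refine hya.2 ?_
    rintro _ ⟨γ, rfl⟩
    obtain ⟨δ, hδ⟩ := hc γ
    exact (hy hδ).trans (hbb ⟨δ, rfl⟩)
  · rintro _ ⟨δ, rfl⟩
    exact hza.1 ⟨f δ, rfl⟩
  · intro b hbb
    refine hza.2 ?_
    rintro _ ⟨γ, rfl⟩
    obtain ⟨δ, hδ⟩ := hc γ
    exact (hbb ⟨δ, rfl⟩).trans (hz hδ)

theorem IsOrderClosed.union {P : Type u} [PartialOrder P] {A B : Set P}
    (hA : IsOrderClosed A) (hB : IsOrderClosed B) : IsOrderClosed (A ∪ B) := by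
  have key : ∀ {C : Set P}, IsOrderClosed C → ∀ (Γ : Type u) [Preorder Γ] [IsDirectedOrder Γ]
      [Nonempty Γ] (x : Γ → P) (a : P), OrderConverges x a →
      (∀ γ, ∃ δ, γ ≤ δ ∧ x δ ∈ C) → a ∈ C := by
    intro C hC Γ _ _ _ x a hxa hcof
    have hd : IsDirectedOrder {δ : Γ // x δ ∈ C} := by
      refine ⟨fun d e => ?_⟩
      obtain ⟨g, h1, h2⟩ := exists_ge_ge d.1 e.1
      obtain ⟨k, h3, h4⟩ := hcof g
      exact ⟨⟨k, h4⟩, h1.trans h3, h2.trans h3⟩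
    have hn : Nonempty {δ : Γ // x δ ∈ C} := by
      obtain ⟨k, _, h4⟩ := hcof (Classical.arbitrary Γ)
      exact ⟨⟨k, h4⟩⟩
    refine hC {δ : Γ // x δ ∈ C} (x ∘ Subtype.val) a (fun δ => δ.2)
      (hxa.comp _ (fun _ _ h => h) fun γ => ?_)
    obtain ⟨k, h3, h4⟩ := hcof γ
    exact ⟨⟨k, h4⟩, h3⟩
  intro Γ _ _ _ x a hx hxa
  by_cases h : ∀ γ, ∃ δ, γ ≤ δ ∧ x δ ∈ A
  · exact Or.inl (key hA Γ x a hxa h)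
  · push Not at h
    obtain ⟨γ₀, h⟩ := h
    refine Or.inr (key hB Γ x a hxa fun γ => ?_)
    obtain ⟨δ, h1, h2⟩ := exists_ge_ge γ₀ γ
    exact ⟨δ, h2, (hx δ).resolve_left (h δ h1)⟩

theorem IsSeqOrderClosed.union {P : Type u} [PartialOrder P] {A B : Set P}
    (hA : IsSeqOrderClosed A) (hB : IsSeqOrderClosed B) : IsSeqOrderClosed (A ∪ B) := by
  have key : ∀ {C : Set P}, IsSeqOrderClosed C → ∀ (x : ℕ → P) (a : P), OrderConverges x a →
      (∃ᶠ n in Filter.atTop, x n ∈ C) → a ∈ C := by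
    intro C hC x a hxa hf
    obtain ⟨φ, hφ, hφC⟩ := Filter.extraction_of_frequently_atTop hf
    exact hC (x ∘ φ) a hφC (hxa.comp φ hφ.monotone fun n => ⟨n, hφ.le_apply⟩)
  intro x a hx hxa
  have h : ∃ᶠ n in Filter.atTop, x n ∈ A ∨ x n ∈ B := (Filter.Eventually.of_forall hx).frequently
  rcases Filter.frequently_or_distrib.1 h with h | h
  · exact Or.inl (key hA x a hxa h)
  · exact Or.inr (key hB x a hxa h)

/-- The order topology `τ_o(P)`: its closed sets are the order closed sets. -/
@[reducible] def orderConvTopology (P : Type u) [PartialOrder P] : TopologicalSpace P :=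
  TopologicalSpace.ofClosed {X : Set P | IsOrderClosed X}
    (fun Γ _ _ _ _ _ hx _ => (hx (Classical.arbitrary Γ)).elim)
    (fun _ hA Γ _ _ _ x a hx hxa X hX => hA hX Γ x a (fun γ => hx γ X hX) hxa)
    (fun _ hA _ hB => IsOrderClosed.union hA hB)

/-- The sequential order topology `τ_os(P)`: its closed sets are the sequentially order closed
sets. -/
@[reducible] def seqOrderConvTopology (P : Type u) [PartialOrder P] : TopologicalSpace P :=
  TopologicalSpace.ofClosed {X : Set P | IsSeqOrderClosed X}
    (fun _ _ hx _ => (hx 0).elim)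
    (fun _ hA x a hx hxa X hX => hA hX x a (fun n => hx n X hX) hxa)
    (fun _ hA _ hB => IsSeqOrderClosed.union hA hB)

namespace VonNeumannAlgebra

/-- The self-adjoint part `M_sa`. As a poset (through the subtype order) it carries the usual
operator order: `x ≤ y` iff `y - x` is positive. -/
def saPart {H : Type*} [NormedAddCommGroup H] [InnerProductSpace ℂ H] [CompleteSpace H]
    (M : VonNeumannAlgebra H) : Set (H →L[ℂ] H) :=
  {x | x ∈ M ∧ IsSelfAdjoint x}

/-- The self-adjoint part `M_sa^1` of the closed unit ball. -/
def saUnitBall {H : Type*} [NormedAddCommGroup H] [InnerProductSpace ℂ H] [CompleteSpace H]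
    (M : VonNeumannAlgebra H) : Set (H →L[ℂ] H) :=
  {x | x ∈ M ∧ IsSelfAdjoint x ∧ ‖x‖ ≤ 1}

/-- The set `P(M)` of projections (self-adjoint idempotents) of `M`. -/
def projections {H : Type*} [NormedAddCommGroup H] [InnerProductSpace ℂ H] [CompleteSpace H]
    (M : VonNeumannAlgebra H) : Set (H →L[ℂ] H) :=
  {p | p ∈ M ∧ IsStarProjection p}

/-- `M` is σ-finite: every set of nonzero pairwise orthogonal projections in `M` is at most
countable. -/
def IsSigmaFinite {H : Type*} [NormedAddCommGroup H] [InnerProductSpace ℂ H] [CompleteSpace H]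
    (M : VonNeumannAlgebra H) : Prop :=
  ∀ S : Set (H →L[ℂ] H), S ⊆ M.projections → (∀ p ∈ S, p ≠ 0) →
    S.Pairwise (fun p q => p * q = 0) → S.Countable

end VonNeumannAlgebra

open Filter Topology ContinuousLinearMap

/-! Each of the three posets `P` satisfies `M.projections ⊆ P ⊆ M.saPart` and contains its strong
sequential limits. The equivalence with σ-finiteness is proved once for every such `P`, through a
maximal family `V` of nonzero vectors whose orbits under the commutant are pairwise orthogonal.
Maximality makes `V` separating for `M`.

If `M` is σ-finite, `V` is countable, because its vectors give orthogonal nonzero cyclic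
projections. For a net with bounds `y`, `z` one then finds a single monotone sequence of indices
along which all the quadratic forms of `z` and `-y` at `V` reach their infima. Since `V` is
separating, this sequence already has the infimum and supremum of the full nets
(`le_of_forall_le_of_antitone`), so sequentially order closed sets are order closed.

If `M` is not σ-finite, `V` can be taken uncountable. The elements of `P` whose forms are positive
at only countably many vectors of `V` make up a sequentially order closed set. It contains the
cyclic projections of finite subsets of `V`, which increase to `1`, but not `1` itself. -/

/-- A directed preorder has monotone sequences dominating a given sequence. -/
theorem exists_monotone_seq_ge {Γ : Type*} [Preorder Γ] [IsDirectedOrder Γ] (h : ℕ → Γ) :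
    ∃ g : ℕ → Γ, Monotone g ∧ ∀ n, h n ≤ g n := by
  choose u hu₁ hu₂ using fun a b : Γ => exists_ge_ge a b
  let g : ℕ → Γ := fun n => Nat.rec (h 0) (fun k a => u a (h (k + 1))) n
  refine ⟨g, monotone_nat_of_le_succ fun n => hu₁ _ _, fun n => ?_⟩
  cases n with
  | zero => exact le_rfl
  | succ k => exact hu₂ _ _

/-- Countably many antitone real functions on a directed set, each bounded below, approach their
infima simultaneously along a monotone sequence. -/
theorem exists_monotone_seq_eventually_le_add {Γ ι : Type*} [Preorder Γ] [IsDirectedOrder Γ]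
    [Nonempty Γ] [Countable ι] (f : ι → Γ → ℝ) (hf : ∀ i, Antitone (f i))
    (hb : ∀ i, BddBelow (Set.range (f i))) :
    ∃ g : ℕ → Γ, Monotone g ∧ ∀ i δ, ∀ ε > 0, ∀ᶠ n in atTop, f i (g n) ≤ f i δ + ε := by
  -- One index for each function and each accuracy `1 / (k + 1)`: countably many in all, so one
  -- monotone sequence dominates them.
  have hex : ∀ p : ι × ℕ, ∃ γ, f p.1 γ < (⨅ δ, f p.1 δ) + 1 / ((p.2 : ℝ) + 1) := fun p =>
    exists_lt_of_ciInf_lt (lt_add_of_pos_right _ Nat.one_div_pos_of_nat)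
  choose e he using hex
  rcases isEmpty_or_nonempty ι with hι | hι
  · exact ⟨fun _ => Classical.arbitrary Γ, monotone_const, fun i => hι.elim i⟩
  obtain ⟨s, hs⟩ := exists_surjective_nat (ι × ℕ)
  obtain ⟨g, hg, hge⟩ := exists_monotone_seq_ge (e ∘ s)
  refine ⟨g, hg, fun i δ ε hε => ?_⟩
  obtain ⟨k, hk⟩ := exists_nat_one_div_lt hε
  obtain ⟨m, hm⟩ := hs (i, k)
  filter_upwards [eventually_ge_atTop m] with n hn
  have h₁ : f i (g n) ≤ f i (e (i, k)) := hf i (by simpa [hm] using (hge m).trans (hg hn))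
  have h₂ := he (i, k)
  have h₃ := ciInf_le (hb i) δ
  dsimp only at h₂
  linarith

/-! ### Quadratic forms and monotone sequences of operators -/

namespace ContinuousLinearMap

variable {H : Type*} [NormedAddCommGroup H] [InnerProductSpace ℂ H]

theorem reApplyInnerSelf_sub (S T : H →L[ℂ] H) (ξ : H) :
    (S - T).reApplyInnerSelf ξ = S.reApplyInnerSelf ξ - T.reApplyInnerSelf ξ := by
  simp [reApplyInnerSelf_apply, inner_sub_left]

theorem reApplyInnerSelf_mono {S T : H →L[ℂ] H} (h : S ≤ T) (ξ : H) :
    S.reApplyInnerSelf ξ ≤ T.reApplyInnerSelf ξ := by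
  have := ((le_def S T).1 h).2 ξ
  change 0 ≤ (T - S).reApplyInnerSelf ξ at this
  rw [reApplyInnerSelf_sub] at this
  linarith

theorem tendsto_reApplyInnerSelf {α : Type*} {l : Filter α} {T : α → H →L[ℂ] H}
    {S : H →L[ℂ] H} {ξ : H} (h : Tendsto (fun i => T i ξ) l (𝓝 (S ξ))) :
    Tendsto (fun i => (T i).reApplyInnerSelf ξ) l (𝓝 (S.reApplyInnerSelf ξ)) :=
  (RCLike.continuous_re.tendsto _).comp (h.inner tendsto_const_nhds)

variable [CompleteSpace H]

theorem le_iff_reApplyInnerSelf_le {S T : H →L[ℂ] H} (hS : IsSelfAdjoint S)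
    (hT : IsSelfAdjoint T) :
    S ≤ T ↔ ∀ ξ, S.reApplyInnerSelf ξ ≤ T.reApplyInnerSelf ξ := by
  refine ⟨reApplyInnerSelf_mono, fun h => ?_⟩
  rw [le_def, isPositive_def']
  exact ⟨hT.sub hS, fun ξ => by rw [reApplyInnerSelf_sub]; linarith [h ξ]⟩

/-- Writing `T = S* S`, use `‖S* S ξ‖ ≤ ‖S*‖ ‖S ξ‖` and the C*-identity `‖T‖ = ‖S‖ ^ 2`. -/
theorem IsPositive.norm_apply_sq_le {T : H →L[ℂ] H} (hT : T.IsPositive) (ξ : H) :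
    ‖T ξ‖ ^ 2 ≤ ‖T‖ * T.reApplyInnerSelf ξ := by
  obtain ⟨S, rfl⟩ := CStarAlgebra.nonneg_iff_eq_star_mul_self.1
    ((nonneg_iff_isPositive T).2 hT)
  have h₀ : (star S * S) ξ = star S (S ξ) := rfl
  have h₁ : (star S * S).reApplyInnerSelf ξ = ‖S ξ‖ ^ 2 := by
    rw [reApplyInnerSelf_apply, h₀, star_eq_adjoint, adjoint_inner_left,
      inner_self_eq_norm_sq]
  rw [h₁, CStarRing.norm_star_mul_self, h₀, ← sq, ← mul_pow]
  gcongr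
  simpa using (star S).le_opNorm (S ξ)

theorem IsPositive.apply_eq_zero {T : H →L[ℂ] H} (hT : T.IsPositive) {ξ : H}
    (h : T.reApplyInnerSelf ξ ≤ 0) : T ξ = 0 := by
  have h₁ := hT.norm_apply_sq_le ξ
  have h₂ : ‖T ξ‖ ^ 2 ≤ 0 := h₁.trans (mul_nonpos_of_nonneg_of_nonpos (norm_nonneg _) h)
  simpa using le_antisymm h₂ (sq_nonneg _)

theorem isSelfAdjoint_of_tendsto {α : Type*} {l : Filter α} [l.NeBot] {T : α → H →L[ℂ] H}
    {S : H →L[ℂ] H} (hT : ∀ i, IsSelfAdjoint (T i))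
    (h : ∀ ξ, Tendsto (fun i => T i ξ) l (𝓝 (S ξ))) : IsSelfAdjoint S := by
  rw [isSelfAdjoint_iff_isSymmetric]
  intro ξ η
  refine tendsto_nhds_unique ((h ξ).inner tendsto_const_nhds)
    ((tendsto_const_nhds.inner (h η)).congr fun i => ?_)
  exact ((isSelfAdjoint_iff_isSymmetric.1 (hT i)) ξ η).symm

/-- Vigier's theorem for sequences: a decreasing sequence of operators that is bounded below
converges strongly. -/
theorem exists_tendsto_of_antitone {T : ℕ → H →L[ℂ] H} (hT : Antitone T) {C : H →L[ℂ] H}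
    (hC : ∀ n, C ≤ T n) :
    ∃ S : H →L[ℂ] H, ∀ ξ, Tendsto (fun n => T n ξ) atTop (𝓝 (S ξ)) := by
  have hcau : ∀ ξ, CauchySeq fun n => T n ξ := by
    intro ξ
    have hr : CauchySeq fun n => (T n).reApplyInnerSelf ξ :=
      (tendsto_atTop_ciInf (fun _ _ h => reApplyInnerSelf_mono (hT h) ξ)
        ⟨C.reApplyInnerSelf ξ, by
          rintro _ ⟨n, rfl⟩
          exact reApplyInnerSelf_mono (hC n) ξ⟩).cauchySeq
    have hle : ∀ N n, N ≤ n → dist (T N ξ) (T n ξ) ^ 2 ≤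
        ‖T 0 - C‖ * dist ((T N).reApplyInnerSelf ξ) ((T n).reApplyInnerSelf ξ) := by
      intro N n hn
      have hp : 0 ≤ T N - T n := sub_nonneg.2 (hT hn)
      have hq : T N - T n ≤ T 0 - C := sub_le_sub (hT (Nat.zero_le N)) (hC n)
      have h₁ := ((nonneg_iff_isPositive _).1 hp).norm_apply_sq_le ξ
      have h₂ : ‖T N - T n‖ ≤ ‖T 0 - C‖ :=
        CStarAlgebra.norm_le_norm_of_nonneg_of_le hp hq
      rw [dist_eq_norm, Real.dist_eq, ← reApplyInnerSelf_sub]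
      exact h₁.trans (mul_le_mul h₂ (le_abs_self _) (((nonneg_iff_isPositive _).1 hp).2 ξ)
        (norm_nonneg _))
    rw [Metric.cauchySeq_iff'] at hr ⊢
    intro ε hε
    -- Adding `1` keeps the divisor positive when `T 0 = C`.
    have hK : 0 < ‖T 0 - C‖ + 1 := by positivity
    obtain ⟨N, hN⟩ := hr (ε ^ 2 / (‖T 0 - C‖ + 1)) (by positivity)
    refine ⟨N, fun n hn => ?_⟩
    have h₁ := hle N n hn
    have h₂ := hN n hn
    rw [dist_comm, lt_div_iff₀ hK] at h₂
    rw [dist_comm]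
    refine lt_of_pow_lt_pow_left₀ 2 hε.le (h₁.trans_lt ?_)
    nlinarith [dist_nonneg (x := (T N).reApplyInnerSelf ξ) (y := (T n).reApplyInnerSelf ξ)]
  choose f hf using fun ξ => cauchySeq_tendsto_of_complete (hcau ξ)
  exact ⟨continuousLinearMapOfTendsto T (tendsto_pi_nhds.2 hf), hf⟩

theorem exists_tendsto_of_monotone {T : ℕ → H →L[ℂ] H} (hT : Monotone T) {C : H →L[ℂ] H}
    (hC : ∀ n, T n ≤ C) :
    ∃ S : H →L[ℂ] H, ∀ ξ, Tendsto (fun n => T n ξ) atTop (𝓝 (S ξ)) := by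
  obtain ⟨S, hS⟩ := exists_tendsto_of_antitone (T := fun n => -T n) (C := -C)
    (fun _ _ h => neg_le_neg (hT h)) (fun n => neg_le_neg (hC n))
  exact ⟨-S, fun ξ => by simpa using (hS ξ).neg⟩

end ContinuousLinearMap

/-! ### Comparison of the two topologies -/

theorem IsOrderClosed.isSeqOrderClosed {P : Type u} [PartialOrder P] {X : Set P}
    (hX : IsOrderClosed X) : IsSeqOrderClosed X := fun x a hx hxa =>
  hX (ULift.{u} ℕ) (x ∘ ULift.down) a (fun n => hx n.down)
    (hxa.comp ULift.down (fun _ _ h => h) fun n => ⟨⟨n⟩, le_rfl⟩)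

theorem seqOrderConvTopology_eq_iff {P : Type u} [PartialOrder P] :
    seqOrderConvTopology P = orderConvTopology P ↔
      ∀ X : Set P, IsSeqOrderClosed X → IsOrderClosed X := by
  have h₁ : ∀ X : Set P, IsClosed[seqOrderConvTopology P] X ↔ IsSeqOrderClosed X := fun X => by
    rw [← @isOpen_compl_iff _ _ (seqOrderConvTopology P)]
    change IsSeqOrderClosed Xᶜᶜ ↔ _
    rw [compl_compl]
  have h₂ : ∀ X : Set P, IsClosed[orderConvTopology P] X ↔ IsOrderClosed X := fun X => by
    rw [← @isOpen_compl_iff _ _ (orderConvTopology P)]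
    change IsOrderClosed Xᶜᶜ ↔ _
    rw [compl_compl]
  rw [TopologicalSpace.ext_iff_isClosed]
  simp only [h₁, h₂]
  exact ⟨fun h X => (h X).1, fun h X => ⟨h X, IsOrderClosed.isSeqOrderClosed⟩⟩

/-! ### Closure under strong sequential limits -/

namespace ContinuousLinearMap

variable {H : Type*} [NormedAddCommGroup H] [InnerProductSpace ℂ H]

/-- A set of operators that contains the limits of its strongly convergent sequences. -/
def IsSeqStrongClosed (P : Set (H →L[ℂ] H)) : Prop :=
  ∀ (T : ℕ → H →L[ℂ] H) (S : H →L[ℂ] H), (∀ n, T n ∈ P) →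
    (∀ ξ, Tendsto (fun n => T n ξ) atTop (𝓝 (S ξ))) → S ∈ P

theorem IsSeqStrongClosed.neg {P : Set (H →L[ℂ] H)} (hP : IsSeqStrongClosed P) :
    IsSeqStrongClosed (-P) := fun T S hT hS =>
  hP (fun n => -T n) (-S) hT fun ξ => by simpa using (hS ξ).neg

end ContinuousLinearMap

namespace VonNeumannAlgebra

variable {H : Type*} [NormedAddCommGroup H] [InnerProductSpace ℂ H] [CompleteSpace H]
  (M : VonNeumannAlgebra H)

/-- Commuting with a fixed operator survives strong limits, and `M` is its own bicommutant. -/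
theorem mem_of_tendsto {T : ℕ → H →L[ℂ] H} {S : H →L[ℂ] H} (hT : ∀ n, T n ∈ M)
    (h : ∀ ξ, Tendsto (fun n => T n ξ) atTop (𝓝 (S ξ))) : S ∈ M := by
  rw [← M.commutant_commutant, mem_commutant_iff]
  intro g hg
  ext ξ
  refine tendsto_nhds_unique ((g.continuous.tendsto _).comp (h ξ)) ((h (g ξ)).congr fun n => ?_)
  exact congr($(mem_commutant_iff.1 hg (T n) (hT n)) ξ)

theorem isSeqStrongClosed_saPart : IsSeqStrongClosed M.saPart := fun _ _ hT h =>
  ⟨M.mem_of_tendsto (fun n => (hT n).1) h, isSelfAdjoint_of_tendsto (fun n => (hT n).2) h⟩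

theorem isSeqStrongClosed_saUnitBall : IsSeqStrongClosed M.saUnitBall := fun T S hT h =>
  ⟨M.mem_of_tendsto (fun n => (hT n).1) h, isSelfAdjoint_of_tendsto (fun n => (hT n).2.1) h,
    S.opNorm_le_bound zero_le_one fun ξ =>
      le_of_tendsto (h ξ).norm (.of_forall fun n => (T n).le_of_opNorm_le (hT n).2.2 ξ)⟩

theorem isSeqStrongClosed_projections : IsSeqStrongClosed M.projections := fun T S hT h => by
  have hsa : IsSelfAdjoint S := isSelfAdjoint_of_tendsto (fun n => (hT n).2.isSelfAdjoint) h
  refine ⟨M.mem_of_tendsto (fun n => (hT n).1) h, ?_, hsa⟩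
  ext ξ
  refine ext_inner_right ℂ fun η => ?_
  have h₁ : inner ℂ ((S * S) ξ) η = inner ℂ (S ξ) (S η) :=
    (isSelfAdjoint_iff_isSymmetric.1 hsa) (S ξ) η
  rw [h₁]
  -- Idempotence passes to the limit because `⟪T n ξ, T n η⟫ = ⟪T n ξ, η⟫` and the inner product is
  -- jointly continuous.
  refine tendsto_nhds_unique ((h ξ).inner (h η))
    (((h ξ).inner tendsto_const_nhds).congr fun n => ?_)
  have h₂ : T n (T n ξ) = T n ξ := congr($((hT n).2.isIdempotentElem) ξ)
  calc inner ℂ (T n ξ) η = inner ℂ (T n (T n ξ)) η := by rw [h₂]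
    _ = _ := (isSelfAdjoint_iff_isSymmetric.1 (hT n).2.isSelfAdjoint) (T n ξ) η

/-! ### Cyclic subspaces and cyclic families -/

/-- The closed linear span of the orbits of the vectors of `A` under the commutant of `M`. -/
noncomputable def cyclicSubspace (A : Set H) : Submodule ℂ H :=
  (Submodule.span ℂ {ζ | ∃ T ∈ M.commutant, ∃ ξ ∈ A, ζ = T ξ}).topologicalClosure

instance (A : Set H) : CompleteSpace (M.cyclicSubspace A) :=
  (Submodule.isClosed_topologicalClosure _).completeSpace_coe

/-- The projection onto `M.cyclicSubspace A`. -/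
noncomputable def cyclicProjection (A : Set H) : H →L[ℂ] H :=
  (M.cyclicSubspace A).starProjection

theorem apply_mem_cyclicSubspace {A : Set H} {ξ : H} (hξ : ξ ∈ A) {T : H →L[ℂ] H}
    (hT : T ∈ M.commutant) : T ξ ∈ M.cyclicSubspace A :=
  Submodule.le_topologicalClosure _ (Submodule.subset_span ⟨T, hT, ξ, hξ, rfl⟩)

theorem mem_cyclicSubspace {A : Set H} {ξ : H} (hξ : ξ ∈ A) : ξ ∈ M.cyclicSubspace A :=
  M.apply_mem_cyclicSubspace hξ (one_mem M.commutant)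

theorem cyclicSubspace_mono {A B : Set H} (h : A ⊆ B) :
    M.cyclicSubspace A ≤ M.cyclicSubspace B :=
  Submodule.topologicalClosure_mono (Submodule.span_mono fun _ ⟨T, hT, ξ, hξ, he⟩ =>
    ⟨T, hT, ξ, h hξ, he⟩)

theorem cyclicSubspace_le_iff {A : Set H} {K : Submodule ℂ H} (hK : IsClosed (K : Set H)) :
    M.cyclicSubspace A ≤ K ↔ ∀ T ∈ M.commutant, ∀ ξ ∈ A, T ξ ∈ K := by
  refine ⟨fun h T hT ξ hξ => h (M.apply_mem_cyclicSubspace hξ hT), fun h => ?_⟩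
  refine Submodule.topologicalClosure_minimal _ (Submodule.span_le.2 ?_) hK
  rintro _ ⟨T, hT, ξ, hξ, rfl⟩
  exact h T hT ξ hξ

theorem mem_orthogonal_cyclicSubspace_iff {A : Set H} {η : H} :
    η ∈ (M.cyclicSubspace A)ᗮ ↔ ∀ T ∈ M.commutant, ∀ ξ ∈ A, inner ℂ (T ξ) η = 0 := by
  have h₁ : η ∈ (M.cyclicSubspace A)ᗮ ↔ M.cyclicSubspace A ≤ (ℂ ∙ η)ᗮ := by
    rw [Submodule.le_orthogonal_iff_le_orthogonal, Submodule.span_singleton_le_iff_mem]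
  rw [h₁, M.cyclicSubspace_le_iff (Submodule.isClosed_orthogonal _)]
  simp only [Submodule.mem_orthogonal_singleton_iff_inner_left]

/-- The range is invariant under the commutant, which puts the projection in `M`. -/
theorem cyclicProjection_mem (A : Set H) : M.cyclicProjection A ∈ M.projections := by
  have hp : IsStarProjection (M.cyclicProjection A) := isStarProjection_starProjection
  refine ⟨(IsStarProjection.mem_iff hp M).2 fun y hy => ?_, hp⟩
  have hr : (M.cyclicProjection A).range = M.cyclicSubspace A := Submodule.range_starProjection _
  rw [hr, Module.End.mem_invtSubmodule]
  refine (M.cyclicSubspace_le_iff ((Submodule.isClosed_topologicalClosure _).preimage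
    y.continuous)).2 fun T hT ξ hξ => ?_
  exact M.apply_mem_cyclicSubspace hξ (mul_mem hy hT)

theorem cyclicProjection_mono {A B : Set H} (h : A ⊆ B) :
    M.cyclicProjection A ≤ M.cyclicProjection B :=
  Submodule.starProjection_le_starProjection_iff.2 (M.cyclicSubspace_mono h)

theorem cyclicProjection_apply {A : Set H} {ξ : H} (h : ξ ∈ M.cyclicSubspace A) :
    M.cyclicProjection A ξ = ξ :=
  Submodule.starProjection_eq_self_iff.2 h

/-- A set of nonzero vectors whose orbits under the commutant of `M` are pairwise orthogonal. -/
structure IsCyclicFamily (V : Set H) : Prop where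
  ne_zero : ∀ ξ ∈ V, ξ ≠ 0
  inner_eq_zero : ∀ ξ ∈ V, ∀ η ∈ V, ξ ≠ η → ∀ T ∈ M.commutant, inner ℂ (T ξ) η = 0

variable {M}

theorem IsCyclicFamily.exists_maximal {V : Set H} (hV : M.IsCyclicFamily V) :
    ∃ W, V ⊆ W ∧ Maximal M.IsCyclicFamily W := by
  refine zorn_subset_nonempty {W | M.IsCyclicFamily W} (fun c hc hchain _ => ?_) V hV
  refine ⟨⋃₀ c, ⟨?_, ?_⟩, fun s hs => Set.subset_sUnion_of_mem hs⟩
  · rintro ξ ⟨s, hs, hξ⟩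
    exact (hc hs).ne_zero ξ hξ
  · rintro ξ ⟨s, hs, hξ⟩ η ⟨t, ht, hη⟩
    rcases hchain.total hs ht with h | h
    · exact (hc ht).inner_eq_zero ξ (h hξ) η hη
    · exact (hc hs).inner_eq_zero ξ hξ η (h hη)

theorem IsCyclicFamily.mem_orthogonal {V A : Set H} (hV : M.IsCyclicFamily V) (hA : A ⊆ V)
    {ξ : H} (hξ : ξ ∈ V) (h : ξ ∉ A) : ξ ∈ (M.cyclicSubspace A)ᗮ :=
  M.mem_orthogonal_cyclicSubspace_iff.2 fun T hT η hη =>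
    hV.inner_eq_zero η (hA hη) ξ hξ (by rintro rfl; exact h hη) T hT

/-- A nonzero vector orthogonal to the cyclic subspace could be adjoined to `V`. -/
theorem cyclicSubspace_eq_top {V : Set H} (hV : Maximal M.IsCyclicFamily V) :
    M.cyclicSubspace V = ⊤ := by
  rw [← Submodule.orthogonal_eq_bot_iff, Submodule.eq_bot_iff]
  intro ζ hζ
  rw [M.mem_orthogonal_cyclicSubspace_iff] at hζ
  by_contra hne
  have hins : M.IsCyclicFamily (insert ζ V) := by
    refine ⟨?_, ?_⟩
    · rintro ξ (rfl | hξ)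
      · exact hne
      · exact hV.1.ne_zero ξ hξ
    · rintro ξ (rfl | hξ) η (rfl | hη) hξη T hT
      · exact (hξη rfl).elim
      · have h₁ := hζ (star T) (star_mem hT) η hη
        rw [star_eq_adjoint, adjoint_inner_left] at h₁
        exact inner_eq_zero_symm.1 h₁
      · exact hζ T hT ξ hξ
      · exact hV.1.inner_eq_zero ξ hξ η hη hξη T hT
  have hmem : ζ ∈ V := hV.2 hins (Set.subset_insert _ _) (Set.mem_insert _ _)
  exact hne (inner_self_eq_zero.1 (hζ 1 (one_mem _) ζ hmem))

/-- The kernel of `x` is closed and invariant under the commutant, so it contains the cyclic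
subspace of `V`, which is everything. -/
theorem eq_zero_of_forall_apply_eq_zero {V : Set H} (hV : Maximal M.IsCyclicFamily V)
    {x : H →L[ℂ] H} (hx : x ∈ M) (h : ∀ ξ ∈ V, x ξ = 0) : x = 0 := by
  have hle : M.cyclicSubspace V ≤ x.ker := by
    refine (M.cyclicSubspace_le_iff x.isClosed_ker).2 fun T hT ξ hξ => ?_
    have h₁ : x (T ξ) = T (x ξ) := congr($(mem_commutant_iff.1 hT x hx) ξ)
    rw [LinearMap.mem_ker]
    exact h₁.trans (by rw [h ξ hξ, map_zero])
  rw [cyclicSubspace_eq_top hV, top_le_iff] at hle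
  ext ξ
  exact LinearMap.mem_ker.1 (hle ▸ Submodule.mem_top : ξ ∈ x.ker)

theorem IsSigmaFinite.countable_of_isCyclicFamily (hM : M.IsSigmaFinite) {V : Set H}
    (hV : M.IsCyclicFamily V) : V.Countable := by
  have hself : ∀ ξ, M.cyclicProjection {ξ} ξ = ξ := fun ξ =>
    M.cyclicProjection_apply (M.mem_cyclicSubspace rfl)
  have horth : ∀ ξ ∈ V, ∀ η ∈ V, ξ ≠ η →
      M.cyclicProjection {ξ} * M.cyclicProjection {η} = 0 := by
    intro ξ hξ η hη hne
    refine Submodule.starProjection_comp_starProjection_eq_zero_iff.2 ?_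
    rw [Submodule.isOrtho_comm]
    refine (M.cyclicSubspace_le_iff (Submodule.isClosed_orthogonal _)).2 ?_
    rintro T hT _ rfl
    rw [M.mem_orthogonal_cyclicSubspace_iff]
    rintro S hS _ rfl
    have h₁ := hV.inner_eq_zero _ hξ _ hη hne (star T * S) (mul_mem (star_mem hT) hS)
    rwa [show (star T * S) _ = adjoint T (S _) from rfl, adjoint_inner_left] at h₁
  have hinj : Set.InjOn (fun ξ => M.cyclicProjection {ξ}) V := by
    intro ξ hξ η hη he
    by_contra hne
    dsimp only at he
    have h₁ : M.cyclicProjection {ξ} (M.cyclicProjection {η} η) = 0 :=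
      congr($(horth ξ hξ η hη hne) η)
    rw [hself, he, hself] at h₁
    exact hV.ne_zero η hη h₁
  refine Set.countable_of_injective_of_countable_image hinj (hM _ ?_ ?_ ?_)
  · rintro _ ⟨ξ, -, rfl⟩
    exact M.cyclicProjection_mem _
  · rintro _ ⟨ξ, hξ, rfl⟩ h0
    have h₁ := hself ξ
    dsimp only at h0
    rw [h0] at h₁
    exact hV.ne_zero ξ hξ h₁.symm
  · rintro _ ⟨ξ, hξ, rfl⟩ _ ⟨η, hη, rfl⟩ hne
    exact horth ξ hξ η hη (by rintro rfl; exact hne rfl)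

/-- Choose a nonzero fixed vector of each projection in an uncountable orthogonal set, then enlarge
by Zorn. -/
theorem exists_uncountable_maximal_isCyclicFamily (hM : ¬ M.IsSigmaFinite) :
    ∃ V, Maximal M.IsCyclicFamily V ∧ ¬ V.Countable := by
  simp only [IsSigmaFinite, not_forall] at hM
  obtain ⟨S, hSM, hS0, hSorth, hSc⟩ := hM
  have hex : ∀ p : S, ∃ ξ, ξ ≠ 0 ∧ p.1 ξ = ξ := by
    rintro ⟨p, hp⟩
    obtain ⟨ξ, hξ⟩ := DFunLike.ne_iff.1 (hS0 p hp)
    exact ⟨p ξ, hξ, congr($((hSM hp).2.isIdempotentElem) ξ)⟩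
  choose v hv0 hv using hex
  have hinj : Function.Injective v := by
    intro p q he
    by_contra hne
    have h₁ : p.1 (q.1 (v q)) = 0 :=
      congr($(hSorth p.2 q.2 fun h => hne (Subtype.ext h)) (v q))
    rw [hv, ← he, hv] at h₁
    exact hv0 p h₁
  have hV : M.IsCyclicFamily (Set.range v) := by
    refine ⟨?_, ?_⟩
    · rintro _ ⟨p, rfl⟩
      exact hv0 p
    · rintro _ ⟨p, rfl⟩ _ ⟨q, rfl⟩ hne T hT
      have h₁ : T (v p) = p.1 (T (v p)) := by
        conv_lhs => rw [← hv p]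
        exact congr($(mem_commutant_iff.1 hT p.1 (hSM p.2).1) (v p)).symm
      have h₂ : p.1 (q.1 (v q)) = 0 :=
        congr($(hSorth p.2 q.2 fun h => hne (congrArg v (Subtype.ext h))) (v q))
      rw [h₁]
      refine ((isSelfAdjoint_iff_isSymmetric.1 (hSM p.2).2.isSelfAdjoint) _ _).trans ?_
      rw [← hv q]
      exact (congrArg _ h₂).trans (inner_zero_right _)
  obtain ⟨W, hVW, hW⟩ := hV.exists_maximal
  refine ⟨W, hW, fun hc => hSc ?_⟩
  have := (hc.mono hVW).to_subtype
  exact Set.countable_coe_iff.1 ((Set.rangeFactorization_injective.2 hinj).countable)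

end VonNeumannAlgebra

/-! ### σ-finiteness makes the topologies agree -/

namespace VonNeumannAlgebra

variable {H : Type*} [NormedAddCommGroup H] [InnerProductSpace ℂ H] [CompleteSpace H]
  {M : VonNeumannAlgebra H}

/-- If a monotone sequence of indices realizes the infima of the diagonal coefficients of a
decreasing net at a maximal cyclic family, the greatest lower bound of the net is also that of the
corresponding subsequence. -/
theorem le_of_forall_le_of_antitone {V : Set H} (hV : Maximal M.IsCyclicFamily V)
    {P : Set (H →L[ℂ] H)} (hPM : P ⊆ M.saPart) (hP : IsSeqStrongClosed P)
    {Γ : Type*} [Preorder Γ] [IsDirectedOrder Γ] {z : Γ → H →L[ℂ] H} (hzP : ∀ γ, z γ ∈ P)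
    (hz : Antitone z) {a : H →L[ℂ] H} (ha : ∀ γ, a ≤ z γ)
    (haG : ∀ b ∈ P, (∀ γ, b ≤ z γ) → b ≤ a) {g : ℕ → Γ} (hg : Monotone g)
    (hgV : ∀ ξ ∈ V, ∀ δ, ∀ ε > 0, ∀ᶠ n in atTop,
      (z (g n)).reApplyInnerSelf ξ ≤ (z δ).reApplyInnerSelf ξ + ε)
    {c : H →L[ℂ] H} (hc : IsSelfAdjoint c) (hcz : ∀ n, c ≤ z (g n)) : c ≤ a := by
  obtain ⟨b, hb⟩ := exists_tendsto_of_antitone (hz.comp_monotone hg) (fun n => ha (g n))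
  have hbP : b ∈ P := hP _ b (fun n => hzP (g n)) hb
  have hba : b ≤ a := by
    refine haG b hbP fun δ => ?_
    -- Refine `g` to a sequence `g'` that also lies above `δ`; its limit `b'` is below `z δ`, and
    -- `b' = b` will follow.
    choose u hu₁ hu₂ using fun n => exists_ge_ge (g n) δ
    obtain ⟨g', hg', hug'⟩ := exists_monotone_seq_ge u
    have hgg' : ∀ n, g n ≤ g' n := fun n => (hu₁ n).trans (hug' n)
    obtain ⟨b', hb'⟩ := exists_tendsto_of_antitone (hz.comp_monotone hg') (fun n => ha (g' n))
    have hb'P : b' ∈ P := hP _ b' (fun n => hzP (g' n)) hb'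
    have hle : b' ≤ b := by
      rw [le_iff_reApplyInnerSelf_le (hPM hb'P).2 (hPM hbP).2]
      exact fun ξ => le_of_tendsto_of_tendsto' (tendsto_reApplyInnerSelf (hb' ξ))
        (tendsto_reApplyInnerSelf (hb ξ)) fun n => reApplyInnerSelf_mono (hz (hgg' n)) ξ
    -- The forms of `b` at `V` are already minimal, so the positive operator `b - b'` kills the
    -- separating family `V`.
    have hzero : b - b' = 0 := by
      refine eq_zero_of_forall_apply_eq_zero hV (sub_mem (hPM hbP).1 (hPM hb'P).1)
        fun ξ hξ => ((le_def _ _).1 hle).apply_eq_zero ?_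
      rw [reApplyInnerSelf_sub, sub_nonpos]
      refine ge_of_tendsto' (tendsto_reApplyInnerSelf (hb' ξ)) fun m => ?_
      refine le_of_forall_pos_le_add fun ε hε => ?_
      exact le_of_tendsto (tendsto_reApplyInnerSelf (hb ξ)) (hgV ξ hξ (g' m) ε hε)
    rw [sub_eq_zero.1 hzero, le_iff_reApplyInnerSelf_le (hPM hb'P).2 (hPM (hzP δ)).2]
    exact fun ξ => le_of_tendsto' (tendsto_reApplyInnerSelf (hb' ξ)) fun n =>
      reApplyInnerSelf_mono (hz ((hu₂ n).trans (hug' n))) ξ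
  refine le_trans ?_ hba
  rw [le_iff_reApplyInnerSelf_le hc (hPM hbP).2]
  exact fun ξ => ge_of_tendsto' (tendsto_reApplyInnerSelf (hb ξ)) fun n =>
    reApplyInnerSelf_mono (hcz n) ξ

theorem IsSigmaFinite.isOrderClosed (hM : M.IsSigmaFinite) {P : Set (H →L[ℂ] H)}
    (hPM : P ⊆ M.saPart) (hP : IsSeqStrongClosed P) {X : Set P} (hX : IsSeqOrderClosed X) :
    IsOrderClosed X := by
  rintro Γ _ _ _ x a hx ⟨y, z, hb, hy, hya, hz, hza⟩
  obtain ⟨V, -, hV⟩ := IsCyclicFamily.exists_maximal (M := M) (V := ∅) ⟨by simp, by simp⟩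
  have := (hM.countable_of_isCyclicFamily hV.1).to_subtype
  have hay : ∀ γ, (y γ).1 ≤ a.1 := fun γ => hya.1 ⟨γ, rfl⟩
  have haz : ∀ γ, a.1 ≤ (z γ).1 := fun γ => hza.1 ⟨γ, rfl⟩
  -- The index type `V ⊕ V` lets one sequence serve both the upper and the lower net.
  obtain ⟨g, hg, hgV⟩ := exists_monotone_seq_eventually_le_add
    (ι := V ⊕ V) (fun i γ => i.elim (fun ξ : V => (z γ).1.reApplyInnerSelf ξ)
      (fun ξ : V => (-(y γ).1).reApplyInnerSelf ξ))
    (by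
      rintro (ξ | ξ) γ δ h
      · exact reApplyInnerSelf_mono (hz h) _
      · exact reApplyInnerSelf_mono (neg_le_neg (hy h : (y γ).1 ≤ (y δ).1)) _)
    (by
      rintro (ξ | ξ)
      · exact ⟨a.1.reApplyInnerSelf ξ, by
          rintro _ ⟨γ, rfl⟩
          exact reApplyInnerSelf_mono (haz γ) _⟩
      · exact ⟨(-a.1).reApplyInnerSelf ξ, by
          rintro _ ⟨γ, rfl⟩
          exact reApplyInnerSelf_mono (neg_le_neg (hay γ)) _⟩)
  refine hX (x ∘ g) a (fun n => hx (g n)) ⟨y ∘ g, z ∘ g, fun n => hb (g n), hy.comp hg,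
    ⟨?_, fun c hc => ?_⟩, hz.comp_monotone hg, ⟨?_, fun c hc => ?_⟩⟩
  · rintro _ ⟨n, rfl⟩
    exact hay (g n)
  · change a.1 ≤ c.1
    -- The supremum of `y` in `P` is treated as an infimum of `-y` in `-P`.
    refine neg_le_neg_iff.1 ?_
    refine le_of_forall_le_of_antitone (P := -P) (z := fun γ => -(y γ).1) hV
      (fun p hp => ?_) hP.neg (fun γ => by simp) (fun γ δ h => neg_le_neg (hy h))
      (fun γ => neg_le_neg (hay γ)) (fun b hbP hle => ?_) hg
      (fun ξ hξ => hgV (.inr ⟨ξ, hξ⟩)) (hPM c.2).2.neg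
      (fun n => neg_le_neg (hc ⟨n, rfl⟩))
    · exact ⟨by simpa using neg_mem (hPM hp).1, by simpa using (hPM hp).2.neg⟩
    · refine le_neg_of_le_neg (?_ : a ≤ (⟨-b, hbP⟩ : P))
      exact hya.2 (by rintro _ ⟨γ, rfl⟩; exact le_neg_of_le_neg (hle γ))
  · rintro _ ⟨n, rfl⟩
    exact haz (g n)
  · exact le_of_forall_le_of_antitone (z := fun γ => (z γ).1) hV hPM hP
      (fun γ => (z γ).2) (fun γ δ h => hz h) haz
      (fun b hbP hle => hza.2 (show (⟨b, hbP⟩ : P) ∈ _ by rintro _ ⟨γ, rfl⟩; exact hle γ)) hg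
      (fun ξ hξ => hgV (.inl ⟨ξ, hξ⟩)) (hPM c.2).2 (fun n => hc ⟨n, rfl⟩)

/-! ### Failure of σ-finiteness separates the topologies -/

theorem exists_finset_mem_cyclicSubspace {V : Set H} {η : H}
    (hη : η ∈ Submodule.span ℂ {ζ | ∃ T ∈ M.commutant, ∃ ξ ∈ V, ζ = T ξ}) :
    ∃ F : Finset V, η ∈ M.cyclicSubspace (Subtype.val '' (F : Set V)) := by
  classical
  have hmono : ∀ F G : Finset V, F ⊆ G →
      M.cyclicSubspace (Subtype.val '' (F : Set V)) ≤
        M.cyclicSubspace (Subtype.val '' (G : Set V)) := fun F G h =>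
    M.cyclicSubspace_mono (Set.image_mono (Finset.coe_subset.2 h))
  induction hη using Submodule.span_induction with
  | mem ζ h =>
    obtain ⟨T, hT, ξ, hξ, rfl⟩ := h
    exact ⟨{⟨ξ, hξ⟩}, M.apply_mem_cyclicSubspace (by simp) hT⟩
  | zero => exact ⟨∅, zero_mem _⟩
  | add ζ ω _ _ h₁ h₂ =>
    obtain ⟨F, hF⟩ := h₁
    obtain ⟨G, hG⟩ := h₂
    exact ⟨F ∪ G, add_mem (hmono _ _ Finset.subset_union_left hF)
      (hmono _ _ Finset.subset_union_right hG)⟩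
  | smul r ζ _ h =>
    obtain ⟨F, hF⟩ := h
    exact ⟨F, Submodule.smul_mem _ _ hF⟩

theorem cyclicProjection_le_one (A : Set H) : M.cyclicProjection A ≤ 1 :=
  (M.cyclicProjection_mem A).2.le_one

/-- The projections onto the cyclic subspaces of the finite subsets of a maximal cyclic family have
least upper bound `1` among the self-adjoint operators. -/
theorem one_le_of_forall_cyclicProjection_le {V : Set H} (hV : Maximal M.IsCyclicFamily V)
    {c : H →L[ℂ] H} (hc : IsSelfAdjoint c)
    (h : ∀ F : Finset V, M.cyclicProjection (Subtype.val '' (F : Set V)) ≤ c) : 1 ≤ c := by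
  rw [le_iff_reApplyInnerSelf_le (.one _) hc]
  have hcl : IsClosed {η : H | (1 : H →L[ℂ] H).reApplyInnerSelf η ≤ c.reApplyInnerSelf η} :=
    isClosed_le (reApplyInnerSelf_continuous _) (reApplyInnerSelf_continuous _)
  intro η
  have hη : η ∈ M.cyclicSubspace V := cyclicSubspace_eq_top hV ▸ Submodule.mem_top
  refine closure_minimal (fun ζ hζ => ?_) hcl hη
  obtain ⟨F, hF⟩ := exists_finset_mem_cyclicSubspace hζ
  have h₁ := reApplyInnerSelf_mono (h F) ζ
  rw [reApplyInnerSelf_apply, M.cyclicProjection_apply hF] at h₁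
  exact h₁

theorem exists_isSeqOrderClosed_not_isOrderClosed (hM : ¬ M.IsSigmaFinite)
    {P : Set (H →L[ℂ] H)} (hPM : P ⊆ M.saPart) (hP : IsSeqStrongClosed P)
    (hproj : M.projections ⊆ P) : ∃ X : Set P, IsSeqOrderClosed X ∧ ¬ IsOrderClosed X := by
  obtain ⟨V, hV, hVc⟩ := exists_uncountable_maximal_isCyclicFamily hM
  refine ⟨{q | {ξ ∈ V | 0 < q.1.reApplyInnerSelf ξ}.Countable}, ?_, fun hX => ?_⟩
  · rintro x a hx ⟨y, z, hb, hy, hya, -, -⟩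
    obtain ⟨b, hyb⟩ := exists_tendsto_of_monotone (T := fun n => (y n).1) (C := a.1)
      (fun _ _ h => hy h) (fun n => hya.1 ⟨n, rfl⟩)
    have hbP : b ∈ P := hP _ b (fun n => (y n).2) hyb
    have hub : ∀ n, (y n).1 ≤ b := fun n => by
      rw [le_iff_reApplyInnerSelf_le (hPM (y n).2).2 (hPM hbP).2]
      intro ξ
      refine ge_of_tendsto (tendsto_reApplyInnerSelf (hyb ξ)) ?_
      filter_upwards [eventually_ge_atTop n] with m hm
      exact reApplyInnerSelf_mono (hy hm) ξ
    -- The strong limit `b` is an upper bound of `y` lying in `P`, hence dominates the supremum `a`.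
    have hab : a.1 ≤ b := hya.2 (show (⟨b, hbP⟩ : P) ∈ _ by rintro _ ⟨n, rfl⟩; exact hub n)
    -- Outside the union of the countable sets of the `x n`, all forms of the `y n` are nonpositive,
    -- hence so are those of `b` and `a`.
    refine (Set.countable_iUnion hx).mono ?_
    rintro ξ ⟨hξV, hξ⟩
    by_contra hcon
    simp only [Set.mem_iUnion, Set.mem_ofPred_eq, not_exists, not_and, not_lt] at hcon
    refine hξ.not_ge ((reApplyInnerSelf_mono hab ξ).trans ?_)
    exact le_of_tendsto' (tendsto_reApplyInnerSelf (hyb ξ)) fun n =>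
      (reApplyInnerSelf_mono (hb n).1 ξ).trans (hcon n hξV)
  · have hone : (1 : H →L[ℂ] H) ∈ P := hproj ⟨one_mem M, .one _⟩
    let p : Finset V → P := fun F =>
      ⟨M.cyclicProjection (Subtype.val '' (F : Set V)), hproj (M.cyclicProjection_mem _)⟩
    have hp : Monotone p := fun F G h =>
      M.cyclicProjection_mono (Set.image_mono (Finset.coe_subset.2 h))
    have hmem := hX (Finset V) p ⟨1, hone⟩ (fun F => ?_)
      ⟨p, fun _ => ⟨1, hone⟩, fun F => ⟨le_rfl, cyclicProjection_le_one _⟩, hp,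
        ⟨by rintro _ ⟨F, rfl⟩; exact cyclicProjection_le_one _, fun c hc =>
          one_le_of_forall_cyclicProjection_le hV (hPM c.2).2 fun F => hc ⟨F, rfl⟩⟩,
        antitone_const, by simp⟩
    · refine hVc (Set.Countable.mono (fun ξ hξ => ?_)
        (show {ξ ∈ V | 0 < (1 : H →L[ℂ] H).reApplyInnerSelf ξ}.Countable from hmem))
      refine ⟨hξ, ?_⟩
      rw [reApplyInnerSelf_apply]
      exact re_inner_self_pos.2 (hV.1.ne_zero ξ hξ)
    -- Vectors of `V` outside `F` are orthogonal to the cyclic subspace of `F`, so `p F` kills them.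
    · refine ((F.finite_toSet.image Subtype.val).subset ?_).countable
      rintro ξ ⟨hξV, hξ⟩
      by_contra hnot
      have h₁ : (p F).1 ξ = 0 := (Submodule.starProjection_apply_eq_zero_iff _).2
        (hV.1.mem_orthogonal (by rintro _ ⟨v, -, rfl⟩; exact v.2) hξV hnot)
      rw [reApplyInnerSelf_apply, h₁, inner_zero_left] at hξ
      simp at hξ

theorem isSigmaFinite_iff_seqOrderConvTopology_eq {P : Set (H →L[ℂ] H)} (hPM : P ⊆ M.saPart)
    (hP : IsSeqStrongClosed P) (hproj : M.projections ⊆ P) :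
    M.IsSigmaFinite ↔ seqOrderConvTopology P = orderConvTopology P := by
  rw [seqOrderConvTopology_eq_iff]
  refine ⟨fun hM X hX => hM.isOrderClosed hPM hP hX, fun h => ?_⟩
  by_contra hM
  obtain ⟨X, hX, hX'⟩ := exists_isSeqOrderClosed_not_isOrderClosed hM hPM hP hproj
  exact hX' (h X hX)

end VonNeumannAlgebra

theorem proposition2p11 {H : Type*} [NormedAddCommGroup H] [InnerProductSpace ℂ H]
    [CompleteSpace H] (M : VonNeumannAlgebra H) :
    [ M.IsSigmaFinite,
      seqOrderConvTopology M.saPart = orderConvTopology M.saPart,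
      seqOrderConvTopology M.saUnitBall = orderConvTopology M.saUnitBall,
      seqOrderConvTopology M.projections = orderConvTopology M.projections ].TFAE := by
  have h₁ := VonNeumannAlgebra.isSigmaFinite_iff_seqOrderConvTopology_eq (M := M) subset_rfl
    M.isSeqStrongClosed_saPart fun p hp => ⟨hp.1, hp.2.isSelfAdjoint⟩
  have h₂ := VonNeumannAlgebra.isSigmaFinite_iff_seqOrderConvTopology_eq (M := M)
    (fun p hp => ⟨hp.1, hp.2.1⟩) M.isSeqStrongClosed_saUnitBall
    fun p hp => ⟨hp.1, hp.2.isSelfAdjoint, hp.2.norm_le⟩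
  have h₃ := VonNeumannAlgebra.isSigmaFinite_iff_seqOrderConvTopology_eq (M := M)
    (fun p hp => ⟨hp.1, hp.2.isSelfAdjoint⟩) M.isSeqStrongClosed_projections subset_rfl
  tfae_have 1 ↔ 2 := h₁
  tfae_have 1 ↔ 3 := h₂
  tfae_have 1 ↔ 4 := h₃
  tfae_finish
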